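/- Let $\Sigma$ be a finite set of letters that is partitioned into calls $\Sigma_c$, returns $\Sigma_r$ and local actions $\Sigma_l$, and let $\bot$ be a fresh symbol, $\Sigma_\bot = \Sigma\cup\{\bot\}$. The stack height of a finite word is defined by $\mathit{sh}(\varepsilon)=0$, $\mathit{sh}(wc)=\mathit{sh}(w)+1$ for $c\in\Sigma_c$, $\mathit{sh}(wr)=\max\{0,\mathit{sh}(w)-1\}$ for $r\in\Sigma_r$, and $\mathit{sh}(wl)=\mathit{sh}(w)$ for $l\in\Sigma_l$. In a finite or infinite word $\alpha=\alpha_0\alpha_1\cdots$, a call $\alpha_k\in\Sigma_c$ is matched if there is a $k'>k$ with $\alpha_{k'}\in\Sigma_r$ and $\mathit{sh}(\alpha_0\cdots\alpha_{k-1})=\mathit{sh}(\alpha_0\cdots\alpha_{k'})$; the return at the smallest such $k'$ is its matching return. A call that is not matched is unmatched. For a set $X$, an $X$-tree is a map $t\colon\{0,1\}^*\to X$; write $x\langle t_0,t_1\rangle$ for the $X$-tree with root label $x$, left-hand subtree $t_0$ (at node $0$) and right-hand subtree $t_1$ (at node $1$). The function $\mathrm{st}$ assigns a $\Sigma_\bot$-tree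 to each finite or infinite word over $\Sigma$ as follows: * $\mathrm{st}(\varepsilon)=\bot\langle\mathrm{st}(\varepsilon),\mathrm{st}(\varepsilon)\rangle$, so all nodes are labeled with $\bot$; * $\mathrm{st}(c\,w\,r\,\alpha)=c\langle\mathrm{st}(r\alpha),\mathrm{st}(w)\rangle$ if $c\in\Sigma_c$ and the displayed $r$ is the matching return of $c$; * $\mathrm{st}(c\,\alpha)=c\langle\mathrm{st}(\varepsilon),\mathrm{st}(\alpha)\rangle$ if $c\in\Sigma_c$ is unmatched; * $\mathrm{st}(x\,\alpha)=x\langle\mathrm{st}(\alpha),\mathrm{st}(\varepsilon)\rangle$ if $x\in\Sigma_l\cup\Sigma_r$. A (nondeterministic) Büchi tree automaton over an alphabet $X$ consists of a finite set $Q$ of states, a transition relation $\Delta\subseteq Q\times X\times Q\times Q$, an initial state $q_I\in Q$ and a set $Q_F\subseteq Q$ of accepting states. It accepts an $X$-tree $t$ if there is a $Q$-tree $r$ with $r(\varepsilon)=q_I$ and $(r(b),t(b),r(b0),r(b1))\in\Delta$ for all $b\in\{0,1\}^*$ such that every infinite branch of $\{0,1\}^*$ contains infinitely many nodes $b$ with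 $r(b)\in Q_F$. **Theorem.** The set $\mathrm{st}(\Sigma^\omega)=\{\mathrm{st}(\alpha)\mid\alpha\in\Sigma^\omega\}$ of the stack trees of all infinite words is regular: there is a Büchi tree automaton over $\Sigma_\bot$ that accepts exactly the trees in $\mathrm{st}(\Sigma^\omega)$. -/

import Mathlib

/-- The three sorts of letters of a pushdown alphabet. -/
inductive LetterKind where
  | call
  | ret
  | loc

/-- A pushdown alphabet on the set `A` of letters: a partition of `A` into calls, returns and
local actions, given by the function that maps each letter to its part. -/
structure PushdownAlphabet (A : Type*) where
  kind : A → LetterKind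

namespace PushdownAlphabet

variable {A : Type*} (S : PushdownAlphabet A)

/-- The set of calls. -/
def calls : Set A := {a | S.kind a = LetterKind.call}

/-- The set of returns. -/
def returns : Set A := {a | S.kind a = LetterKind.ret}

/-- The set of local actions. -/
def locals : Set A := {a | S.kind a = LetterKind.loc}

/-- The effect of one letter on the stack height. A return on the empty stack leaves it empty:
the subtraction of natural numbers is `max 0 (h - 1)`. -/
def heightStep (h : ℕ) (a : A) : ℕ :=
  match S.kind a with
  | LetterKind.call => h + 1
  | LetterKind.ret => h - 1
  | LetterKind.loc => h

/-- The stack height reached after reading a finite word from left to right. -/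
def stackHeight (w : List A) : ℕ := w.foldl S.heightStep 0

/-- Finite and infinite words are both elements of `Stream'.Seq A`. In the word `u` there is a call at
position `k`, and `k'` is the position of its matching return: the smallest position after `k` that
carries a return and after which the stack height is again the one before the call. -/
def IsMatchingReturn (u : Stream'.Seq A) (k k' : ℕ) : Prop :=
  (∃ c ∈ u.get? k, c ∈ S.calls) ∧
    IsLeast {j | k < j ∧ (∃ r ∈ u.get? j, r ∈ S.returns) ∧
      S.stackHeight (u.take k) = S.stackHeight (u.take (j + 1))} k'

open Classical in
/-- The word that is encoded in the left-hand subtree of the stack tree of a word: if the word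
starts with a matched call, the suffix that starts with the matching return; if it starts with an
unmatched call, the empty word; if it starts with a return or a local action, the remaining word. -/
noncomputable def leftWord (u : Stream'.Seq A) : Stream'.Seq A :=
  match u.head with
  | none => Stream'.Seq.nil
  | some a =>
    if a ∈ S.calls then
      if h : ∃ k', S.IsMatchingReturn u 0 k' then u.drop h.choose else Stream'.Seq.nil
    else u.tail

open Classical in
/-- The word that is encoded in the right-hand subtree of the stack tree of a word: if the word
starts with a matched call, the nested infix, which lies strictly between the call and its matching
return; if it starts with an unmatched call, the remaining word; if it starts with a return or a
local action, the empty word. -/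
noncomputable def rightWord (u : Stream'.Seq A) : Stream'.Seq A :=
  match u.head with
  | none => Stream'.Seq.nil
  | some a =>
    if a ∈ S.calls then
      if h : ∃ k', S.IsMatchingReturn u 0 k' then Stream'.Seq.ofList (u.tail.take (h.choose - 1))
      else u.tail
    else Stream'.Seq.nil

end PushdownAlphabet

/-- Nodes of the infinite binary tree: finite words over the Booleans, where `false` is the
direction to the left and `true` the direction to the right. The children of `b` are
`b ++ [false]` and `b ++ [true]`. -/
abbrev TreeNode := List Bool

/-- Infinite binary trees with labels in `B`. -/
abbrev LabeledTree (B : Type*) := TreeNode → B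

/-- The stack tree of a finite or infinite word. `none : Option A` is the fresh symbol `⊥`. -/
noncomputable def stackTree {A : Type*} (S : PushdownAlphabet A) :
    Stream'.Seq A → LabeledTree (Option A)
  | u, [] => u.head
  | u, false :: b => stackTree S (S.leftWord u) b
  | u, true :: b => stackTree S (S.rightWord u) b


/-- The set of the stack trees of all infinite words. -/
def stackTrees {A : Type*} (S : PushdownAlphabet A) : Set (LabeledTree (Option A)) :=
  {t | ∃ α : Stream' A, t = stackTree S (Stream'.Seq.ofStream α)}

/-- The prefix of length `n` of a branch. -/
def branchPrefix (β : ℕ → Bool) (n : ℕ) : TreeNode := (List.range n).map β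

/-- A nondeterministic tree automaton with Büchi acceptance, with alphabet `B` and set `Q` of
states (finiteness of `Q` is required where the automata are quantified over). -/
structure BuchiTreeAutomaton (B Q : Type*) where
  trans : Set (Q × B × Q × Q)
  init : Q
  accept : Set Q

namespace BuchiTreeAutomaton

variable {B Q : Type*} (T : BuchiTreeAutomaton B Q)

/-- `r` is a run on the tree `t`. -/
def IsRun (t : LabeledTree B) (r : LabeledTree Q) : Prop :=
  r [] = T.init ∧ ∀ b : TreeNode, (r b, t b, r (b ++ [false]), r (b ++ [true])) ∈ T.trans

/-- Every branch of `r` contains infinitely many nodes labeled with accepting states. -/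
def IsAccepting (r : LabeledTree Q) : Prop :=
  ∀ β : ℕ → Bool, {n : ℕ | r (branchPrefix β n) ∈ T.accept}.Infinite

/-- The set of the trees that have an accepting run. -/
def language : Set (LabeledTree B) :=
  {t | ∃ r, T.IsRun t r ∧ T.IsAccepting r}

end BuchiTreeAutomaton

/-- A set of trees is regular if some Büchi tree automaton with finitely many states
recognizes it. -/
def IsRegularTreeSet {B : Type*} (L : Set (LabeledTree B)) : Prop :=
  ∃ (Q : Type) (_ : Finite Q) (T : BuchiTreeAutomaton B Q), T.language = L

/-! The stack tree of an infinite word has a single spine of nodes whose subtrees encode infinite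
words; off it hang only trees of balanced words and of the empty word. The automaton walks down the
tree and guesses at each call whether it is matched. A wrong guess can show in two ways. A call
guessed to be unmatched may be followed by a return that matches it; the flag `u = false` rules this
out by forbidding unmatched returns after such a call. And the word nested in a call guessed to be
matched may fail to be finite; the Büchi condition rules this out, because the states `fin` are not
accepting.

Matching is expressed by heights counted from 1 after the call: the call is matched exactly if the
height reaches 0, and the truncated subtraction plays no role before that.

From words to runs, `Fits.exists_trans` supplies the run step by step, together with a length bound
that decreases at each `fin` state, so no branch stays in these states. From runs to words,
acceptance makes the `fin` regions well-founded, and `encodesFinite_of_accepts` reads off balanced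
words by induction. Along the spine, `exists_treeStep` splits off one nonempty block at a time; the
concatenation of the blocks is the desired word, and `TreeStep.apply_eq_stackTree` compares its
stack tree with the given tree by induction on the depth of the node. -/

open Stream' (Seq)
open Stream'.Seq (cons nil append ofList ofStream)

/-! ### Stack heights that stay positive -/

namespace PushdownAlphabet

variable {A : Type*} {S : PushdownAlphabet A}

theorem heightStep_call {c : A} (hc : c ∈ S.calls) (h : ℕ) : S.heightStep h c = h + 1 := by
  simp only [calls, Set.mem_ofPred_eq] at hc
  simp [heightStep, hc]

theorem heightStep_return {r : A} (hr : r ∈ S.returns) (h : ℕ) : S.heightStep h r = h - 1 := by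
  simp only [returns, Set.mem_ofPred_eq] at hr
  simp [heightStep, hr]

theorem heightStep_local {a : A} (ha : a ∈ S.locals) (h : ℕ) : S.heightStep h a = h := by
  simp only [locals, Set.mem_ofPred_eq] at ha
  simp [heightStep, ha]

theorem mem_calls_or_returns_or_locals (S : PushdownAlphabet A) (a : A) :
    a ∈ S.calls ∨ a ∈ S.returns ∨ a ∈ S.locals := by
  simp only [calls, returns, locals, Set.mem_ofPred_eq]
  cases S.kind a <;> simp

theorem notMem_calls_of_mem_returns {a : A} (ha : a ∈ S.returns) : a ∉ S.calls := by
  simp only [calls, returns, Set.mem_ofPred_eq] at *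
  simp [ha]

theorem notMem_calls_of_mem_locals {a : A} (ha : a ∈ S.locals) : a ∉ S.calls := by
  simp only [calls, locals, Set.mem_ofPred_eq] at *
  simp [ha]

theorem heightStep_mono {h h' : ℕ} (hh : h ≤ h') (a : A) :
    S.heightStep h a ≤ S.heightStep h' a := by
  unfold heightStep
  cases S.kind a <;> simp <;> omega

theorem heightStep_add {h : ℕ} (hh : 0 < h) (k : ℕ) (a : A) :
    S.heightStep (h + k) a = S.heightStep h a + k := by
  unfold heightStep
  cases S.kind a <;> simp <;> omega

theorem foldl_heightStep_mono (w : List A) {h h' : ℕ} (hh : h ≤ h') :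
    w.foldl S.heightStep h ≤ w.foldl S.heightStep h' := by
  induction w generalizing h h' with
  | nil => exact hh
  | cons a w ih => exact ih (heightStep_mono hh a)

/-- When the word is read from stack height `h`, the stack height stays positive throughout. -/
def StaysPositive (S : PushdownAlphabet A) (h : ℕ) (u : Seq A) : Prop :=
  ∀ n, 0 < (u.take n).foldl S.heightStep h

theorem StaysPositive.pos {h : ℕ} {u : Seq A} (hu : S.StaysPositive h u) : 0 < h := by
  simpa using hu 0

theorem staysPositive_nil {h : ℕ} : S.StaysPositive h nil ↔ 0 < h := by
  simp [StaysPositive]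

theorem staysPositive_cons {h : ℕ} {a : A} {u : Seq A} :
    S.StaysPositive h (cons a u) ↔ 0 < h ∧ S.StaysPositive (S.heightStep h a) u := by
  refine ⟨fun hu => ⟨hu.pos, fun n => by simpa using hu (n + 1)⟩, fun ⟨hh, hu⟩ n => ?_⟩
  cases n with
  | zero => simpa using hh
  | succ n => simpa using hu n

theorem StaysPositive.add {h : ℕ} {u : Seq A} (hu : S.StaysPositive h u) (k : ℕ) :
    S.StaysPositive (h + k) u :=
  fun n => (hu n).trans_le (foldl_heightStep_mono _ (Nat.le_add_right h k))

theorem StaysPositive.foldl_pos {h : ℕ} {w : List A} (hw : S.StaysPositive h (ofList w)) :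
    0 < w.foldl S.heightStep h := by
  induction w generalizing h with
  | nil => exact hw.pos
  | cons a w ih =>
    rw [Seq.ofList_cons, staysPositive_cons] at hw
    exact ih hw.2

/-- As long as the height is positive, the subtraction is never truncated, so reading commutes with
a shift of the initial height. -/
theorem StaysPositive.foldl_add {h : ℕ} {w : List A} (hw : S.StaysPositive h (ofList w)) (k : ℕ) :
    w.foldl S.heightStep (h + k) = w.foldl S.heightStep h + k := by
  induction w generalizing h with
  | nil => rfl
  | cons a w ih =>
    rw [Seq.ofList_cons, staysPositive_cons] at hw
    rw [List.foldl_cons, List.foldl_cons, heightStep_add hw.1, ih hw.2]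

theorem staysPositive_append {h : ℕ} {w : List A} {u : Seq A} :
    S.StaysPositive h (append (ofList w) u) ↔
      S.StaysPositive h (ofList w) ∧ S.StaysPositive (w.foldl S.heightStep h) u := by
  induction w generalizing h with
  | nil =>
    simp only [Seq.ofList_nil, Seq.nil_append, List.foldl_nil, staysPositive_nil]
    exact ⟨fun hu => ⟨hu.pos, hu⟩, fun hu => hu.2⟩
  | cons a w ih =>
    simp only [Seq.ofList_cons, Seq.cons_append, staysPositive_cons, List.foldl_cons, ih, and_assoc]

/-- If the stack height does not stay positive, it drops to zero at some return. -/
theorem exists_return_of_not_staysPositive {h : ℕ} (hh : 0 < h) {u : Seq A}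
    (hu : ¬ S.StaysPositive h u) :
    ∃ (w : List A) (r : A) (v : Seq A), u = append (ofList w) (cons r v) ∧ r ∈ S.returns ∧
      S.StaysPositive h (ofList w) ∧ w.foldl S.heightStep h = 1 := by
  simp only [StaysPositive, not_forall, not_lt, nonpos_iff_eq_zero] at hu
  obtain ⟨n, hn⟩ := hu
  induction n generalizing h u with
  | zero => simp at hn; omega
  | succ n ih =>
    cases u using Stream'.Seq.recOn with
    | nil => simp at hn; omega
    | cons a u =>
      rw [Seq.take_succ_cons, List.foldl_cons] at hn
      rcases Nat.eq_zero_or_pos (S.heightStep h a) with h0 | h0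
      · have ha : a ∈ S.returns := by
          rcases S.mem_calls_or_returns_or_locals a with ha | ha | ha
          · rw [heightStep_call ha] at h0; omega
          · exact ha
          · rw [heightStep_local ha] at h0; omega
        rw [heightStep_return ha] at h0
        refine ⟨[], a, u, by simp, ha, ?_, ?_⟩
        · simpa [staysPositive_nil] using hh
        · simp only [List.foldl_nil]; omega
      · obtain ⟨w, r, v, rfl, hr, hw, h1⟩ := ih h0 hn
        refine ⟨a :: w, r, v, by simp [Seq.ofList_cons, Seq.cons_append], hr, ?_, h1⟩
        rw [Seq.ofList_cons, staysPositive_cons]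
        exact ⟨hh, hw⟩

/-! ### Balanced words -/

/-- All calls and all returns of the finite word are matched. -/
def IsBalanced (S : PushdownAlphabet A) (w : List A) : Prop :=
  S.StaysPositive 1 (ofList w) ∧ w.foldl S.heightStep 1 = 1

theorem isBalanced_nil : S.IsBalanced [] := by
  simp [IsBalanced, staysPositive_nil]

theorem IsBalanced.staysPositive {w : List A} (hw : S.IsBalanced w) {h : ℕ} (hh : 0 < h) :
    S.StaysPositive h (ofList w) := by
  obtain ⟨k, rfl⟩ := Nat.exists_eq_add_of_le (Nat.succ_le_of_lt hh)
  exact hw.1.add k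

theorem IsBalanced.foldl {w : List A} (hw : S.IsBalanced w) {h : ℕ} (hh : 0 < h) :
    w.foldl S.heightStep h = h := by
  obtain ⟨k, rfl⟩ := Nat.exists_eq_add_of_le (Nat.succ_le_of_lt hh)
  rw [Nat.succ_eq_add_one, zero_add, hw.1.foldl_add, hw.2]

theorem isBalanced_local_cons {a : A} (ha : a ∈ S.locals) {w : List A} :
    S.IsBalanced (a :: w) ↔ S.IsBalanced w := by
  simp [IsBalanced, staysPositive_cons, heightStep_local ha]

theorem staysPositive_local_cons {a : A} (ha : a ∈ S.locals) {h : ℕ} {u : Seq A} :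
    S.StaysPositive h (cons a u) ↔ S.StaysPositive h u := by
  rw [staysPositive_cons, heightStep_local ha]
  exact ⟨fun hu => hu.2, fun hu => ⟨hu.pos, hu⟩⟩

theorem not_staysPositive_return_cons {r : A} (hr : r ∈ S.returns) {u : Seq A} :
    ¬ S.StaysPositive 1 (cons r u) := by
  rw [staysPositive_cons, heightStep_return hr]
  exact fun hu => absurd hu.2.pos (by simp)

/-- The block `c w r` ends at its initial height and never goes below it, so it can be cut out. -/
theorem staysPositive_call_balanced_return {c r : A} (hc : c ∈ S.calls) (hr : r ∈ S.returns)
    {w : List A} (hw : S.IsBalanced w) {h : ℕ} {u : Seq A} :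
    S.StaysPositive h (cons c (append (ofList w) (cons r u))) ↔ S.StaysPositive h u := by
  have := hw.staysPositive h.succ_pos
  rw [staysPositive_cons, staysPositive_append, heightStep_call hc, hw.foldl h.succ_pos,
    staysPositive_cons, heightStep_return hr]
  exact ⟨fun hu => hu.2.2.2, fun hu => ⟨hu.pos, this, h.succ_pos, hu⟩⟩

theorem ofList_cons_append_cons (c r : A) (w v : List A) :
    ofList (c :: (w ++ r :: v)) = cons c (append (ofList w) (cons r (ofList v))) := by
  rw [Seq.ofList_cons, Seq.ofList_append, Seq.ofList_cons]

theorem isBalanced_call_balanced_return {c r : A} (hc : c ∈ S.calls) (hr : r ∈ S.returns)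
    {w : List A} (hw : S.IsBalanced w) {v : List A} :
    S.IsBalanced (c :: (w ++ r :: v)) ↔ S.IsBalanced v := by
  rw [IsBalanced, ofList_cons_append_cons, staysPositive_call_balanced_return hc hr hw, IsBalanced,
    List.foldl_cons, List.foldl_append, heightStep_call hc, hw.foldl (by simp), List.foldl_cons,
    heightStep_return hr]

theorem not_isBalanced_return_cons {r : A} (hr : r ∈ S.returns) {w : List A} :
    ¬ S.IsBalanced (r :: w) := fun h =>
  not_staysPositive_return_cons hr (Seq.ofList_cons r w ▸ h.1)

theorem exists_eq_ofList_of_append {w u : List A} {v : Seq A}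
    (h : ofList u = append (ofList w) v) : ∃ v', v = ofList v' ∧ u = w ++ v' := by
  induction w generalizing u with
  | nil => exact ⟨u, by simpa using h.symm, rfl⟩
  | cons a w ih =>
    cases u with
    | nil => simp [Seq.cons_append] at h
    | cons b u =>
      rw [Seq.ofList_cons, Seq.ofList_cons, Seq.cons_append, Seq.cons_eq_cons] at h
      obtain ⟨rfl, h⟩ := h
      obtain ⟨v', rfl, rfl⟩ := ih h
      exact ⟨v', rfl, rfl⟩

theorem exists_eq_ofList_cons {u : List A} {a : A} {v : Seq A}
    (h : ofList u = cons a v) : ∃ v', v = ofList v' ∧ u = a :: v' := by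
  cases u with
  | nil => simp at h
  | cons b u =>
    rw [Seq.ofList_cons, Seq.cons_eq_cons] at h
    exact ⟨u, h.2.symm, by rw [h.1]⟩

/-- A balanced word that starts with a call has the form `c w r v` where `w` and `v` are balanced. -/
theorem IsBalanced.exists_of_call {c : A} (hc : c ∈ S.calls) {u : List A}
    (hu : S.IsBalanced (c :: u)) :
    ∃ (w : List A) (r : A) (v : List A), u = w ++ r :: v ∧ r ∈ S.returns ∧ S.IsBalanced w ∧
      S.IsBalanced v := by
  -- Otherwise the 1 added by the call would never be removed, and the final height would exceed 1.
  have hn : ¬ S.StaysPositive 1 (ofList u) := fun h => by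
    have h1 := hu.2
    rw [List.foldl_cons, heightStep_call hc, h.foldl_add] at h1
    have := h.foldl_pos
    omega
  obtain ⟨w, r, v, h, hr, hw, h1⟩ := exists_return_of_not_staysPositive one_pos hn
  obtain ⟨v', h', rfl⟩ := exists_eq_ofList_of_append h
  obtain ⟨v, rfl, rfl⟩ := exists_eq_ofList_cons h'.symm
  have hw' : S.IsBalanced w := ⟨hw, h1⟩
  exact ⟨w, r, v, rfl, hr, hw', (isBalanced_call_balanced_return hc hr hw').1 hu⟩

/-! ### Infinite words, prefixes and concatenation -/

/-- The word is infinite. -/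
def IsInfinite (u : Seq A) : Prop := ∃ α : Stream' A, u = ofStream α

theorem IsInfinite.exists_cons {u : Seq A} (hu : IsInfinite u) :
    ∃ a v, u = cons a v ∧ IsInfinite v := by
  obtain ⟨α, rfl⟩ := hu
  refine ⟨α.head, _, ?_, α.tail, rfl⟩
  rw [← Seq.ofStream_cons, Stream'.eta]

theorem isInfinite_cons {a : A} {u : Seq A} : IsInfinite (cons a u) ↔ IsInfinite u := by
  constructor
  · intro h
    obtain ⟨b, v, h, hv⟩ := h.exists_cons
    rw [Seq.cons_eq_cons] at h
    exact h.2 ▸ hv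
  · rintro ⟨α, rfl⟩
    exact ⟨Stream'.cons a α, (Seq.ofStream_cons a α).symm⟩

theorem isInfinite_append {w : List A} {u : Seq A} :
    IsInfinite (append (ofList w) u) ↔ IsInfinite u := by
  induction w with
  | nil => simp
  | cons a w ih => rw [Seq.ofList_cons, Seq.cons_append, isInfinite_cons, ih]

theorem append_get?_length (w : List A) (u : Seq A) :
    (append (ofList w) u).get? w.length = u.head := by
  induction w with
  | nil => simp [Seq.head]
  | cons a w ih =>
    rw [Seq.ofList_cons, Seq.cons_append, List.length_cons, Seq.get?_cons_succ, ih]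

theorem append_drop_length (w : List A) (u : Seq A) :
    (append (ofList w) u).drop w.length = u := by
  induction w with
  | nil => simp
  | cons a w ih =>
    rw [Seq.ofList_cons, Seq.cons_append, List.length_cons, Seq.drop_succ_cons, ih]

theorem take_append_of_le (w : List A) (u : Seq A) {n : ℕ} (hn : n ≤ w.length) :
    (append (ofList w) u).take n = (ofList w).take n := by
  induction w generalizing n with
  | nil => obtain rfl : n = 0 := by simpa using hn
           simp
  | cons a w ih =>
    cases n with
    | zero => simp
    | succ n =>
      rw [Seq.ofList_cons, Seq.cons_append, Seq.take_succ_cons, Seq.take_succ_cons,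
        ih (by simpa using hn)]

theorem take_length_add_append (w : List A) (u : Seq A) (n : ℕ) :
    (append (ofList w) u).take (w.length + n) = w ++ u.take n := by
  induction w with
  | nil => simp
  | cons a w ih =>
    rw [Seq.ofList_cons, Seq.cons_append, List.length_cons, Nat.add_right_comm,
      Seq.take_succ_cons, ih, List.cons_append]

/-! ### Matching returns and the words of the two subtrees -/

theorem isMatchingReturn_of_isBalanced {c r : A} (hc : c ∈ S.calls) (hr : r ∈ S.returns)
    {w : List A} (hw : S.IsBalanced w) (u : Seq A) :
    S.IsMatchingReturn (cons c (append (ofList w) (cons r u))) 0 (w.length + 1) := by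
  refine ⟨⟨c, by simp, hc⟩, ⟨Nat.succ_pos _, ⟨r, ?_, hr⟩, ?_⟩, ?_⟩
  · rw [Seq.get?_cons_succ, append_get?_length, Seq.head_cons]; rfl
  · rw [Seq.take_succ_cons, take_length_add_append]
    simp [stackHeight, heightStep_call hc, hw.2, heightStep_return hr]
  -- An earlier candidate would end inside `c w`, where the height is still positive, while the
  -- height before the call is 0.
  · rintro j ⟨hj, -, hh⟩
    by_contra hlt
    rw [Seq.take_succ_cons, take_append_of_le _ _ (by omega)] at hh
    simp only [stackHeight, Seq.take_zero, List.foldl_nil, List.foldl_cons, heightStep_call hc]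
      at hh
    have := hw.1 j
    simp only [zero_add] at hh
    omega

theorem not_isMatchingReturn_of_staysPositive {c : A} (hc : c ∈ S.calls) {u : Seq A}
    (hu : S.StaysPositive 1 u) (k : ℕ) : ¬ S.IsMatchingReturn (cons c u) 0 k := by
  rintro ⟨-, ⟨-, -, hh⟩, -⟩
  rw [Seq.take_succ_cons] at hh
  simp only [stackHeight, Seq.take_zero, List.foldl_nil, List.foldl_cons, heightStep_call hc,
    zero_add] at hh
  have := hu k
  omega

theorem take_length_append (w : List A) (u : Seq A) :
    (append (ofList w) u).take w.length = w := by
  simpa using take_length_add_append w u 0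

theorem leftWord_nil : S.leftWord nil = nil := by simp [leftWord]

theorem rightWord_nil : S.rightWord nil = nil := by simp [rightWord]

theorem leftWord_cons_of_notMem_calls {a : A} (ha : a ∉ S.calls) (u : Seq A) :
    S.leftWord (cons a u) = u := by simp [leftWord, ha]

theorem rightWord_cons_of_notMem_calls {a : A} (ha : a ∉ S.calls) (u : Seq A) :
    S.rightWord (cons a u) = nil := by simp [rightWord, ha]

theorem leftWord_unmatched {c : A} (hc : c ∈ S.calls) {u : Seq A} (hu : S.StaysPositive 1 u) :
    S.leftWord (cons c u) = nil := by
  simp [leftWord, hc, not_isMatchingReturn_of_staysPositive hc hu]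

theorem rightWord_unmatched {c : A} (hc : c ∈ S.calls) {u : Seq A} (hu : S.StaysPositive 1 u) :
    S.rightWord (cons c u) = u := by
  simp [rightWord, hc, not_isMatchingReturn_of_staysPositive hc hu]

theorem leftWord_matched {c r : A} (hc : c ∈ S.calls) (hr : r ∈ S.returns)
    {w : List A} (hw : S.IsBalanced w) (u : Seq A) :
    S.leftWord (cons c (append (ofList w) (cons r u))) = cons r u := by
  have hm := isMatchingReturn_of_isBalanced hc hr hw u
  have h : ∃ k, S.IsMatchingReturn (cons c (append (ofList w) (cons r u))) 0 k := ⟨_, hm⟩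
  -- Least elements are unique, which determines the chosen position.
  have hk : h.choose = w.length + 1 := h.choose_spec.2.unique hm.2
  simp only [leftWord, Seq.head_cons, hc, if_true, dif_pos h]
  rw [hk, Seq.drop_succ_cons, append_drop_length]

theorem rightWord_matched {c r : A} (hc : c ∈ S.calls) (hr : r ∈ S.returns)
    {w : List A} (hw : S.IsBalanced w) (u : Seq A) :
    S.rightWord (cons c (append (ofList w) (cons r u))) = ofList w := by
  have hm := isMatchingReturn_of_isBalanced hc hr hw u
  have h : ∃ k, S.IsMatchingReturn (cons c (append (ofList w) (cons r u))) 0 k := ⟨_, hm⟩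
  have hk : h.choose = w.length + 1 := h.choose_spec.2.unique hm.2
  simp only [rightWord, Seq.head_cons, hc, if_true, dif_pos h, Seq.tail_cons]
  rw [hk, Nat.add_sub_cancel, take_length_append]

end PushdownAlphabet

/-! ### The automaton -/

/-- The state `bot` is for the tree of the empty word, a state `fin m` for the tree of a balanced
word, and a state `inf u m` for the tree of an infinite word, which may contain unmatched returns
only if `u = true`. If `m = true`, the word is preceded by the matching return of the last call. -/
inductive StackState where
  | bot
  | inf (u m : Bool)
  | fin (m : Bool)

instance : Finite StackState :=
  Finite.of_injective (β := Bool ⊕ Bool × Bool ⊕ Bool)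
    (fun | .bot => .inl true | .inf u m => .inr (.inl (u, m)) | .fin m => .inr (.inr m))
    (by rintro (_ | _ | _) (_ | _ | _) <;> simp)

namespace PushdownAlphabet

variable {A : Type*} {S : PushdownAlphabet A}

/-- The transitions of the automaton that recognizes the stack trees. -/
inductive StackTrans (S : PushdownAlphabet A) :
    StackState → Option A → StackState → StackState → Prop
  | bot : StackTrans S .bot none .bot .bot
  | infFlat {u : Bool} {a : A} : a ∉ S.calls → (u = false → a ∈ S.locals) →
      StackTrans S (.inf u false) (some a) (.inf u false) .bot
  | infUnmatched {u : Bool} {c : A} : c ∈ S.calls →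
      StackTrans S (.inf u false) (some c) .bot (.inf false false)
  | infMatched {u : Bool} {c : A} : c ∈ S.calls →
      StackTrans S (.inf u false) (some c) (.inf u true) (.fin false)
  | infReturn {u : Bool} {r : A} : r ∈ S.returns →
      StackTrans S (.inf u true) (some r) (.inf u false) .bot
  | finNil : StackTrans S (.fin false) none .bot .bot
  | finLocal {a : A} : a ∈ S.locals → StackTrans S (.fin false) (some a) (.fin false) .bot
  | finCall {c : A} : c ∈ S.calls → StackTrans S (.fin false) (some c) (.fin true) (.fin false)
  | finReturn {r : A} : r ∈ S.returns → StackTrans S (.fin true) (some r) (.fin false) .bot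

/-- The Büchi tree automaton that recognizes the stack trees of the infinite words. -/
def stackAutomaton (S : PushdownAlphabet A) : BuchiTreeAutomaton (Option A) StackState where
  trans := {p | S.StackTrans p.1 p.2.1 p.2.2.1 p.2.2.2}
  init := .inf true false
  accept := {q | ∀ m, q ≠ .fin m}

/-! ### From words to accepting runs -/

/-- The infinite word has no unmatched return, unless `u = true`. -/
def IsInfiniteWord (S : PushdownAlphabet A) (u : Bool) (v : Seq A) : Prop :=
  IsInfinite v ∧ (u = false → S.StaysPositive 1 v)

/-- The words whose stack trees are accepted from a given state; `k` bounds the number of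
non-accepting states in sequence. -/
def Fits (S : PushdownAlphabet A) : StackState → Seq A → ℕ → Prop
  | .bot, v, _ => v = nil
  | .inf u false, v, _ => S.IsInfiniteWord u v
  | .inf u true, v, _ => ∃ r v', v = cons r v' ∧ r ∈ S.returns ∧ S.IsInfiniteWord u v'
  | .fin false, v, k => ∃ w, v = ofList w ∧ S.IsBalanced w ∧ w.length < k
  | .fin true, v, k => ∃ r w, v = cons r (ofList w) ∧ r ∈ S.returns ∧ S.IsBalanced w ∧
      w.length + 1 < k

/-- The guesses are made according to the word itself. At an accepting state the bounds of the
children are free; at a `fin` state they can decrease because both children encode shorter words. -/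
theorem Fits.exists_trans {q : StackState} {v : Seq A} {k : ℕ} (h : S.Fits q v k) :
    ∃ ql qr kl kr, S.StackTrans q v.head ql qr ∧ S.Fits ql (S.leftWord v) kl ∧
      S.Fits qr (S.rightWord v) kr ∧ (q ∉ S.stackAutomaton.accept → kl < k ∧ kr < k) := by
  have hbot : S.Fits .bot nil 0 := rfl
  match q, h with
  | .bot, h =>
    obtain rfl : v = nil := h
    refine ⟨_, _, 0, 0, by rw [Seq.head_nil]; exact .bot, ?_, ?_, ?_⟩
    · rwa [leftWord_nil]
    · rwa [rightWord_nil]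
    · simp [stackAutomaton]
  | .inf u true, ⟨r, v', hv, hr, hv'⟩ =>
    subst hv
    have hn := notMem_calls_of_mem_returns hr
    refine ⟨_, _, 0, 0, by rw [Seq.head_cons]; exact .infReturn hr, ?_, ?_, ?_⟩
    · rwa [leftWord_cons_of_notMem_calls hn]
    · rwa [rightWord_cons_of_notMem_calls hn]
    · simp [stackAutomaton]
  | .inf u false, ⟨hi, hp⟩ =>
    obtain ⟨a, v, rfl, hi'⟩ := hi.exists_cons
    rw [Seq.head_cons]
    by_cases hc : a ∈ S.calls
    -- The first case is that of an unmatched call, and `hs` is just what the flag `false` demands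
    -- of the rest.
    · by_cases hs : S.StaysPositive 1 v
      · refine ⟨_, _, 0, 0, .infUnmatched hc, ?_, ?_, ?_⟩
        · rwa [leftWord_unmatched hc hs]
        · rw [rightWord_unmatched hc hs]
          exact ⟨hi', fun _ => hs⟩
        · simp [stackAutomaton]
      · obtain ⟨w, r, v, rfl, hr, hw, h1⟩ := exists_return_of_not_staysPositive one_pos hs
        have hw' : S.IsBalanced w := ⟨hw, h1⟩
        refine ⟨_, _, 0, w.length + 1, .infMatched hc, ?_, ?_, ?_⟩
        · rw [leftWord_matched hc hr hw']
          rw [isInfinite_append, isInfinite_cons] at hi'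
          exact ⟨r, v, rfl, hr, hi', fun hu =>
            (staysPositive_call_balanced_return hc hr hw').1 (hp hu)⟩
        · rw [rightWord_matched hc hr hw']
          exact ⟨w, rfl, hw', Nat.lt_succ_self _⟩
        · simp [stackAutomaton]
    · have hl : u = false → a ∈ S.locals := fun hu => by
        rcases S.mem_calls_or_returns_or_locals a with ha | ha | ha
        · exact absurd ha hc
        · exact absurd (hp hu) (not_staysPositive_return_cons ha)
        · exact ha
      refine ⟨_, _, 0, 0, .infFlat hc hl, ?_, ?_, ?_⟩
      · rw [leftWord_cons_of_notMem_calls hc]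
        exact ⟨hi', fun hu => (staysPositive_local_cons (hl hu)).1 (hp hu)⟩
      · rwa [rightWord_cons_of_notMem_calls hc]
      · simp [stackAutomaton]
  | .fin true, ⟨r, w, hv, hr, hw, hk⟩ =>
    subst hv
    have hn := notMem_calls_of_mem_returns hr
    refine ⟨_, _, w.length + 1, 0, by rw [Seq.head_cons]; exact .finReturn hr, ?_, ?_, ?_⟩
    · rw [leftWord_cons_of_notMem_calls hn]
      exact ⟨w, rfl, hw, Nat.lt_succ_self _⟩
    · rwa [rightWord_cons_of_notMem_calls hn]
    · exact fun _ => ⟨hk, by omega⟩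
  | .fin false, ⟨[], hv, _, hk⟩ =>
    rw [Seq.ofList_nil] at hv
    subst hv
    refine ⟨_, _, 0, 0, by rw [Seq.head_nil]; exact .finNil, ?_, ?_, fun _ => ⟨?_, ?_⟩⟩
    · rwa [leftWord_nil]
    · rwa [rightWord_nil]
    all_goals omega
  | .fin false, ⟨a :: w, hv, hw, hk⟩ =>
    rw [List.length_cons] at hk
    subst hv
    rcases S.mem_calls_or_returns_or_locals a with ha | ha | ha
    · obtain ⟨w, r, v, rfl, hr, hw', hv⟩ := hw.exists_of_call ha
      rw [ofList_cons_append_cons, Seq.head_cons, leftWord_matched ha hr hw',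
        rightWord_matched ha hr hw']
      simp only [List.length_append, List.length_cons] at hk
      -- The least bounds that `Fits` permits for `r v` and `w`; both are below `k`, which exceeds
      -- the length of `c w r v`.
      exact ⟨_, _, v.length + 2, w.length + 1, .finCall ha,
        ⟨r, v, rfl, hr, hv, Nat.lt_succ_self _⟩, ⟨w, rfl, hw', Nat.lt_succ_self _⟩,
        fun _ => by omega⟩
    · exact absurd hw (not_isBalanced_return_cons ha)
    · have hn := notMem_calls_of_mem_locals ha
      rw [Seq.ofList_cons, Seq.head_cons, leftWord_cons_of_notMem_calls hn,
        rightWord_cons_of_notMem_calls hn]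
      exact ⟨_, _, w.length + 1, 0, .finLocal ha,
        ⟨w, rfl, (isBalanced_local_cons ha).1 hw, Nat.lt_succ_self _⟩, hbot, fun _ => by omega⟩

end PushdownAlphabet

/-- The label at a node of the tree that is generated from `x` by the functions that map each label
to those of its left and right child. -/
def generatedTree {X : Type*} (f : Bool → X → X) (x : X) : LabeledTree X
  | [] => x
  | d :: b => generatedTree f (f d x) b

theorem generatedTree_append {X : Type*} (f : Bool → X → X) (x : X) (b : TreeNode) (d : Bool) :
    generatedTree f x (b ++ [d]) = f d (generatedTree f x b) := by
  induction b generalizing x with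
  | nil => rfl
  | cons e b ih => exact ih _

theorem branchPrefix_succ (β : ℕ → Bool) (n : ℕ) :
    branchPrefix β (n + 1) = branchPrefix β n ++ [β n] := by
  simp [branchPrefix, List.range_succ]

namespace PushdownAlphabet

variable {A : Type*} {S : PushdownAlphabet A}

/-- Both trees unfold from the root, one direction at a time. This relates the labels of the input
tree to the words carried along by the run. -/
theorem stackTree_eq_head (f : Bool → StackState × Seq A × ℕ → StackState × Seq A × ℕ)
    {P : StackState × Seq A × ℕ → Prop} (hP : ∀ p, P p → ∀ d, P (f d p))
    (hl : ∀ p, P p → (f false p).2.1 = S.leftWord p.2.1)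
    (hr : ∀ p, P p → (f true p).2.1 = S.rightWord p.2.1) (b : TreeNode)
    (p : StackState × Seq A × ℕ) (hp : P p) :
    stackTree S p.2.1 b = (generatedTree f p b).2.1.head := by
  induction b generalizing p with
  | nil => rfl
  | cons d b ih =>
    rw [generatedTree, ← ih _ (hP p hp d)]
    cases d
    · rw [hl p hp]; rfl
    · rw [hr p hp]; rfl

theorem stackTrees_subset_language : stackTrees S ⊆ S.stackAutomaton.language := by
  rintro _ ⟨α, rfl⟩
  have key : ∀ p : StackState × Seq A × ℕ, ∃ p' : Bool → StackState × Seq A × ℕ,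
      S.Fits p.1 p.2.1 p.2.2 → S.StackTrans p.1 p.2.1.head (p' false).1 (p' true).1 ∧
        (p' false).2.1 = S.leftWord p.2.1 ∧ (p' true).2.1 = S.rightWord p.2.1 ∧
        ∀ d, S.Fits (p' d).1 (p' d).2.1 (p' d).2.2 ∧
          (p.1 ∉ S.stackAutomaton.accept → (p' d).2.2 < p.2.2) := by
    intro p
    by_cases h : S.Fits p.1 p.2.1 p.2.2
    · obtain ⟨ql, qr, kl, kr, ht, hl, hr, hk⟩ := h.exists_trans
      refine ⟨fun d => bif d then (qr, S.rightWord p.2.1, kr) else (ql, S.leftWord p.2.1, kl),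
        fun _ => ⟨ht, rfl, rfl, ?_⟩⟩
      rintro (_ | _)
      · exact ⟨hl, fun hq => (hk hq).1⟩
      · exact ⟨hr, fun hq => (hk hq).2⟩
    -- An arbitrary value: triples that do not fit are never reached.
    · exact ⟨fun _ => p, fun h' => absurd h' h⟩
  choose g hg using key
  set f : Bool → StackState × Seq A × ℕ → StackState × Seq A × ℕ := fun d p => g p d with hf
  set p₀ : StackState × Seq A × ℕ := (.inf true false, ofStream α, 0) with hp₀
  have h0 : S.Fits p₀.1 p₀.2.1 p₀.2.2 := ⟨⟨α, rfl⟩, by simp⟩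
  have hfit : ∀ b p, S.Fits p.1 p.2.1 p.2.2 →
      S.Fits (generatedTree f p b).1 (generatedTree f p b).2.1 (generatedTree f p b).2.2 := by
    intro b p hp
    induction b generalizing p with
    | nil => exact hp
    | cons d b ih => exact ih _ ((hg p hp).2.2.2 d).1
  have hfit₀ := fun b => hfit b p₀ h0
  refine ⟨fun b => (generatedTree f p₀ b).1, ⟨rfl, fun b => ?_⟩, fun β => ?_⟩
  · have := stackTree_eq_head (S := S) f (P := fun p => S.Fits p.1 p.2.1 p.2.2)
      (fun p hp d => ((hg p hp).2.2.2 d).1) (fun p hp => (hg p hp).2.1)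
      (fun p hp => (hg p hp).2.2.1) b p₀ h0
    dsimp only
    rw [generatedTree_append, generatedTree_append, show ofStream α = p₀.2.1 from rfl, this]
    exact (hg _ (hfit₀ b)).1
  · refine Nat.frequently_atTop_iff_infinite.1 (Filter.frequently_atTop.2 fun n => ?_)
    -- Induction on the bound at the current node: if the node is not accepting, the bound is
    -- smaller at the next node of the branch.
    induction hk : (generatedTree f p₀ (branchPrefix β n)).2.2 using Nat.strong_induction_on
      generalizing n with
    | _ k ih =>
    by_cases ha : (generatedTree f p₀ (branchPrefix β n)).1 ∈ S.stackAutomaton.accept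
    · exact ⟨n, le_rfl, ha⟩
    · have hlt := ((hg _ (hfit₀ (branchPrefix β n))).2.2.2 (β n)).2 ha
      obtain ⟨m, hnm, hm⟩ := ih _ (hk ▸ hlt) (n + 1)
        (by rw [branchPrefix_succ, generatedTree_append])
      exact ⟨m, by omega, hm⟩

end PushdownAlphabet

/-! ### From accepting runs to words -/

/-- The tree with the given root label and the given subtrees. -/
def LabeledTree.node {B : Type*} (x : B) (l r : LabeledTree B) : LabeledTree B
  | [] => x
  | false :: b => l b
  | true :: b => r b

theorem LabeledTree.eq_node {B : Type*} (t : LabeledTree B) :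
    t = .node (t []) (fun b => t (false :: b)) (fun b => t (true :: b)) := by
  funext b
  match b with
  | [] => rfl
  | false :: b => rfl
  | true :: b => rfl

/-- If a property of nodes holds at the accepting nodes, and at each other node at whose children
it holds, then it holds at the root, provided that each branch has infinitely many accepting
nodes. -/
theorem BuchiTreeAutomaton.IsAccepting.root_induction {B Q : Type*} {T : BuchiTreeAutomaton B Q}
    {r : LabeledTree Q} (hr : T.IsAccepting r) {P : TreeNode → Prop}
    (hacc : ∀ b, r b ∈ T.accept → P b) (hstep : ∀ b, (∀ d, P (b ++ [d])) → P b) : P [] := by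
  by_contra h
  have key : ∀ b, ∃ d, ¬ P b → ¬ P (b ++ [d]) := fun b => by
    by_cases hb : P b
    · exact ⟨true, fun h => absurd hb h⟩
    · by_contra! hd
      exact hb (hstep b fun d => (hd d).2)
  choose f hf using key
  -- From a root without the property, `g` moves on to a child without it forever; this branch would
  -- avoid all accepting nodes.
  let g : ℕ → TreeNode := fun n => n.rec [] fun _ b => b ++ [f b]
  have hg : ∀ n, branchPrefix (fun n => f (g n)) n = g n := fun n => by
    induction n with
    | zero => rfl
    | succ n ih => rw [branchPrefix_succ, ih]
  have hP : ∀ n, ¬ P (g n) := fun n => by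
    induction n with
    | zero => exact h
    | succ n ih => exact hf _ ih
  obtain ⟨n, hn⟩ := (hr fun n => f (g n)).nonempty
  rw [Set.mem_ofPred_eq, hg] at hn
  exact hP n (hacc _ hn)

theorem branchPrefix_cons (d : Bool) (β : ℕ → Bool) (n : ℕ) :
    branchPrefix (fun k => Nat.casesOn k d β) (n + 1) = d :: branchPrefix β n := by
  simp [branchPrefix, List.range_succ_eq_map]

namespace BuchiTreeAutomaton

variable {B Q : Type*} {T : BuchiTreeAutomaton B Q}

theorem IsAccepting.subtree {r : LabeledTree Q} (hr : T.IsAccepting r) (d : Bool) :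
    T.IsAccepting (fun b => r (d :: b)) := by
  intro β
  refine Nat.frequently_atTop_iff_infinite.1 (Filter.frequently_atTop.2 fun n => ?_)
  obtain ⟨m, hm, hmem⟩ := Filter.frequently_atTop.1
    (Nat.frequently_atTop_iff_infinite.2 (hr fun k => Nat.casesOn k d β)) (n + 1)
  obtain ⟨m, rfl⟩ : ∃ m', m = m' + 1 := ⟨m - 1, by omega⟩
  rw [branchPrefix_cons] at hmem
  exact ⟨m, by omega, hmem⟩

/-- The automaton accepts the tree from the state `q`. -/
def Accepts (T : BuchiTreeAutomaton B Q) (q : Q) (t : LabeledTree B) : Prop :=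
  ∃ r : LabeledTree Q, r [] = q ∧
    (∀ b : TreeNode, (r b, t b, r (b ++ [false]), r (b ++ [true])) ∈ T.trans) ∧ T.IsAccepting r

theorem Accepts.exists_trans {q : Q} {t : LabeledTree B} (h : T.Accepts q t) :
    ∃ ql qr, (q, t [], ql, qr) ∈ T.trans ∧ T.Accepts ql (fun b => t (false :: b)) ∧
      T.Accepts qr (fun b => t (true :: b)) := by
  obtain ⟨r, rfl, hr, ha⟩ := h
  exact ⟨_, _, hr [], ⟨_, rfl, fun b => hr (false :: b), ha.subtree false⟩,
    ⟨_, rfl, fun b => hr (true :: b), ha.subtree true⟩⟩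

end BuchiTreeAutomaton

namespace PushdownAlphabet

variable {A : Type*} {S : PushdownAlphabet A}

theorem stackTree_eq_node (u : Seq A) :
    stackTree S u = .node u.head (stackTree S (S.leftWord u)) (stackTree S (S.rightWord u)) :=
  LabeledTree.eq_node _

theorem stackTree_nil : stackTree S nil = fun _ => none := by
  funext b
  induction b with
  | nil => rfl
  | cons d b ih =>
    cases d
    · rw [stackTree, leftWord_nil, ih]
    · rw [stackTree, rightWord_nil, ih]

theorem stackTree_cons_of_notMem_calls {a : A} (ha : a ∉ S.calls) (u : Seq A) :
    stackTree S (cons a u) = .node (some a) (stackTree S u) (stackTree S nil) := by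
  rw [stackTree_eq_node, Seq.head_cons, leftWord_cons_of_notMem_calls ha,
    rightWord_cons_of_notMem_calls ha]

theorem stackTree_unmatched {c : A} (hc : c ∈ S.calls) {u : Seq A} (hu : S.StaysPositive 1 u) :
    stackTree S (cons c u) = .node (some c) (stackTree S nil) (stackTree S u) := by
  rw [stackTree_eq_node, Seq.head_cons, leftWord_unmatched hc hu, rightWord_unmatched hc hu]

theorem stackTree_matched {c r : A} (hc : c ∈ S.calls) (hr : r ∈ S.returns)
    {w : List A} (hw : S.IsBalanced w) (u : Seq A) :
    stackTree S (cons c (append (ofList w) (cons r u))) =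
      .node (some c) (.node (some r) (stackTree S u) (stackTree S nil))
        (stackTree S (ofList w)) := by
  rw [stackTree_eq_node, Seq.head_cons, leftWord_matched hc hr hw, rightWord_matched hc hr hw,
    stackTree_cons_of_notMem_calls (notMem_calls_of_mem_returns hr)]

/-- The only transition from `bot` reads `⊥` and stays in `bot` on both sides. -/
theorem eq_stackTree_nil_of_accepts_bot {t : LabeledTree (Option A)}
    (ht : S.stackAutomaton.Accepts .bot t) : t = stackTree S nil := by
  rw [stackTree_nil]
  funext b
  induction b generalizing t with
  | nil =>
    obtain ⟨ql, qr, h, -, -⟩ := ht.exists_trans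
    change S.StackTrans _ _ _ _ at h
    generalize t [] = x at h
    cases h
    rfl
  | cons d b ih =>
    obtain ⟨ql, qr, h, hl, hr⟩ := ht.exists_trans
    change S.StackTrans _ _ _ _ at h
    generalize t [] = x at h
    cases h
    cases d
    · exact ih hl
    · exact ih hr

/-- The tree encodes a balanced word, to which the return at the root is prepended if `m = true`. -/
def EncodesFinite (S : PushdownAlphabet A) (m : Bool) (t : LabeledTree (Option A)) : Prop :=
  match m with
  | false => ∃ w, t = stackTree S (ofList w) ∧ S.IsBalanced w
  | true => ∃ r w, t = .node (some r) (stackTree S (ofList w)) (stackTree S nil) ∧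
      r ∈ S.returns ∧ S.IsBalanced w

/-- The induction step for `encodesFinite_of_accepts`: at a call, the right-hand subtree provides
`w`, the left-hand one provides `r v`, and they combine to `c w r v`. -/
theorem encodesFinite_of_stackTrans {m : Bool} {t : LabeledTree (Option A)} {ql qr : StackState}
    (h : S.StackTrans (.fin m) (t []) ql qr)
    (hbot : qr = .bot → (fun b => t (true :: b)) = stackTree S nil)
    (hbot' : ql = .bot → (fun b => t (false :: b)) = stackTree S nil)
    (hl : ∀ m, ql = .fin m → S.EncodesFinite m fun b => t (false :: b))
    (hr : ∀ m, qr = .fin m → S.EncodesFinite m fun b => t (true :: b)) :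
    S.EncodesFinite m t := by
  rw [t.eq_node]
  generalize t [] = x at *
  cases h with
  | finNil =>
    rw [hbot rfl, hbot' rfl]
    refine ⟨[], ?_, isBalanced_nil⟩
    have h := stackTree_eq_node (S := S) nil
    rw [leftWord_nil, rightWord_nil, Seq.head_nil] at h
    rw [Seq.ofList_nil]
    exact h.symm
  | finLocal ha =>
    rw [hbot rfl]
    obtain ⟨w, hw, hb⟩ := hl _ rfl
    refine ⟨_ :: w, ?_, (isBalanced_local_cons ha).2 hb⟩
    rw [hw, Seq.ofList_cons, stackTree_cons_of_notMem_calls (notMem_calls_of_mem_locals ha)]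
  | finCall hc =>
    obtain ⟨r, v, hv, hret, hbv⟩ := hl _ rfl
    obtain ⟨w, hw, hbw⟩ := hr _ rfl
    refine ⟨_ :: (w ++ r :: v), ?_, (isBalanced_call_balanced_return hc hret hbw).2 hbv⟩
    rw [hv, hw, ofList_cons_append_cons, stackTree_matched hc hret hbw]
  | finReturn hret =>
    rw [hbot rfl]
    obtain ⟨w, hw, hb⟩ := hl _ rfl
    exact ⟨_, w, by rw [hw], hret, hb⟩

/-- No branch stays in `fin` states forever, so `root_induction` applies; at accepting nodes the
claim is vacuous. -/
theorem encodesFinite_of_accepts {m : Bool} {t : LabeledTree (Option A)}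
    (ht : S.stackAutomaton.Accepts (.fin m) t) : S.EncodesFinite m t := by
  obtain ⟨r, h0, hr, ha⟩ := ht
  have hsub : ∀ b : TreeNode, S.stackAutomaton.Accepts (r b) (fun b' => t (b ++ b')) := fun b => by
    refine ⟨fun b' => r (b ++ b'), congrArg r b.append_nil, fun b' => ?_, ?_⟩
    · simpa using hr (b ++ b')
    · clear h0 hr
      induction b generalizing r with
      | nil => exact ha
      | cons d b ih => exact ih _ (ha.subtree d)
  refine ha.root_induction
    (P := fun b => ∀ m, r b = .fin m → S.EncodesFinite m fun b' => t (b ++ b'))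
    (fun b hb m hm => absurd hm (hb m)) (fun b hd m hm => ?_) m h0
  have e : ∀ d, (fun b' => t (b ++ [d] ++ b')) = fun b' => t (b ++ d :: b') := fun d => by
    simp
  have hs := fun d => e d ▸ hsub (b ++ [d])
  refine encodesFinite_of_stackTrans (ql := r (b ++ [false])) (qr := r (b ++ [true])) ?_
    (fun hq => eq_stackTree_nil_of_accepts_bot (hq ▸ hs true))
    (fun hq => eq_stackTree_nil_of_accepts_bot (hq ▸ hs false))
    (fun m hm => e false ▸ hd false m hm) (fun m hm => e true ▸ hd true m hm)
  rw [List.append_nil, ← hm]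
  exact hr b

/-- The tree `t` encodes the infinite word `x α` if `t'` encodes `α`, where the nonempty finite word
`x` is a return or local action, an unmatched call, or a balanced word in a matched call and
return. -/
inductive TreeStep (S : PushdownAlphabet A) :
    Bool → LabeledTree (Option A) → List A → Bool → LabeledTree (Option A) → Prop
  | flat {u : Bool} {a : A} {t : LabeledTree (Option A)} : a ∉ S.calls → (u = false → a ∈ S.locals) →
      TreeStep S u (.node (some a) t (stackTree S nil)) [a] u t
  | unmatched {u : Bool} {c : A} {t : LabeledTree (Option A)} : c ∈ S.calls →
      TreeStep S u (.node (some c) (stackTree S nil) t) [c] false t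
  | matched {u : Bool} {c r : A} {w : List A} {t : LabeledTree (Option A)} : c ∈ S.calls →
      r ∈ S.returns → S.IsBalanced w →
      TreeStep S u (.node (some c) (.node (some r) t (stackTree S nil)) (stackTree S (ofList w)))
        (c :: (w ++ [r])) u t

/-- No state `inf` can read `⊥`, so a letter can always be split off. A matched call takes two
transitions, since its left child, in state `inf u true`, must read the return. -/
theorem exists_treeStep {u : Bool} {t : LabeledTree (Option A)}
    (ht : S.stackAutomaton.Accepts (.inf u false) t) :
    ∃ x u' t', S.TreeStep u t x u' t' ∧ S.stackAutomaton.Accepts (.inf u' false) t' := by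
  obtain ⟨ql, qr, h, hl, hr⟩ := ht.exists_trans
  change S.StackTrans _ _ _ _ at h
  rw [t.eq_node]
  generalize t [] = x at *
  cases h with
  | infFlat hc hu =>
    rw [eq_stackTree_nil_of_accepts_bot hr]
    exact ⟨_, _, _, .flat hc hu, hl⟩
  | infUnmatched hc =>
    rw [eq_stackTree_nil_of_accepts_bot hl]
    exact ⟨_, _, _, .unmatched hc, hr⟩
  | infMatched hc =>
    obtain ⟨w, hw, hb⟩ := encodesFinite_of_accepts hr
    rw [hw]
    obtain ⟨ql, qr, h, hl', hr'⟩ := hl.exists_trans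
    change S.StackTrans _ _ _ _ at h
    rw [LabeledTree.eq_node fun b => t (false :: b)]
    generalize t [false] = x at *
    cases h with
    | infReturn hret =>
      rw [eq_stackTree_nil_of_accepts_bot hr']
      exact ⟨_, _, _, .matched hc hret hb, hl'⟩

theorem TreeStep.ne_nil {u u' : Bool} {t t' : LabeledTree (Option A)} {x : List A}
    (h : S.TreeStep u t x u' t') : x ≠ [] := by
  cases h <;> simp

theorem TreeStep.target_eq_false {u' : Bool} {t t' : LabeledTree (Option A)} {x : List A}
    (h : S.TreeStep false t x u' t') : u' = false := by
  cases h <;> rfl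

theorem TreeStep.staysPositive {u' : Bool} {t t' : LabeledTree (Option A)} {x : List A}
    (h : S.TreeStep false t x u' t') {k : ℕ} (hk : 0 < k) : S.StaysPositive k (ofList x) := by
  cases h with
  | flat hc hu =>
    rw [Seq.ofList_cons, staysPositive_local_cons (hu rfl), Seq.ofList_nil, staysPositive_nil]
    exact hk
  | unmatched hc =>
    rw [Seq.ofList_cons, staysPositive_cons, Seq.ofList_nil, staysPositive_nil, heightStep_call hc]
    exact ⟨hk, k.succ_pos⟩
  | matched hc hr hw =>
    rw [ofList_cons_append_cons, staysPositive_call_balanced_return hc hr hw, Seq.ofList_nil,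
      staysPositive_nil]
    exact hk

/-! ### Concatenating the blocks along the spine -/

/-- The infinite concatenation of the words `x s`, `x (f s)`, `x (f (f s))` and so on, with the
word `l` prepended. -/
def concatStream {X : Type*} (x : X → List A) (hx : ∀ s, x s ≠ []) (f : X → X) (l : List A) (s : X) :
    Stream' A :=
  Stream'.corec (fun p : List A × X => match p with
      | ([], s) => (x s).head (hx s)
      | (a :: _, _) => a)
    (fun p => match p with
      | ([], s) => ((x s).tail, f s)
      | (_ :: l, s) => (l, s)) (l, s)

theorem concatStream_cons {X : Type*} (x : X → List A) (hx : ∀ s, x s ≠ []) (f : X → X) (a : A)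
    (l : List A) (s : X) :
    concatStream x hx f (a :: l) s = Stream'.cons a (concatStream x hx f l s) := by
  rw [concatStream, Stream'.corec_eq]; rfl

theorem concatStream_eq_append {X : Type*} (x : X → List A) (hx : ∀ s, x s ≠ []) (f : X → X)
    (l : List A) (s : X) :
    ofStream (concatStream x hx f l s) =
      append (ofList l) (ofStream (concatStream x hx f [] s)) := by
  induction l with
  | nil => simp
  | cons a l ih =>
    rw [concatStream_cons, Seq.ofStream_cons, ih, Seq.ofList_cons, Seq.cons_append]

theorem concatStream_nil {X : Type*} (x : X → List A) (hx : ∀ s, x s ≠ []) (f : X → X) (s : X) :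
    ofStream (concatStream x hx f [] s) =
      append (ofList (x s)) (ofStream (concatStream x hx f [] (f s))) := by
  rw [← concatStream_eq_append]
  congr 1
  rw [concatStream, Stream'.corec_eq]
  conv_rhs => rw [← List.cons_head_tail (hx s)]
  rw [concatStream_cons]
  rfl

/-- Blocks are nonempty, so removing one shortens the prefix under consideration. The height must be
arbitrary, since a block may raise it. -/
theorem staysPositive_of_append_step {X : Type*} {x : X → List A} {f : X → X} {v : X → Seq A}
    (hx : ∀ s, x s ≠ []) (hv : ∀ s, v s = append (ofList (x s)) (v (f s))) {P : X → Prop}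
    (hP : ∀ s, P s → P (f s)) (hpos : ∀ s, P s → ∀ h, 0 < h → S.StaysPositive h (ofList (x s)))
    {s : X} (hs : P s) {h : ℕ} (hh : 0 < h) : S.StaysPositive h (v s) := by
  intro n
  induction n using Nat.strong_induction_on generalizing s h with
  | _ n ih =>
  rw [hv]
  rcases le_total n (x s).length with hn | hn
  · rw [take_append_of_le _ _ hn]
    exact hpos s hs h hh n
  · obtain ⟨m, rfl⟩ := Nat.exists_eq_add_of_le hn
    rw [take_length_add_append, List.foldl_append]
    have := List.length_pos_iff.2 (hx s)
    exact ih m (by omega) (hP s hs) (hpos s hs h hh).foldl_pos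

/-- The tree `t'` sits strictly below the root of `t`, so shorter nodes suffice. The hypothesis on
`v` is needed for an unmatched call: it keeps the call unmatched in the whole word. -/
theorem TreeStep.apply_eq_stackTree {u u' : Bool} {t t' : LabeledTree (Option A)} {x : List A}
    (h : S.TreeStep u t x u' t') {v : Seq A} (hv : u' = false → S.StaysPositive 1 v) (b : TreeNode)
    (ih : ∀ b' : TreeNode, b'.length < b.length → t' b' = stackTree S v b') :
    t b = stackTree S (append (ofList x) v) b := by
  cases h with
  | flat hc hu =>
    rw [Seq.ofList_cons, Seq.ofList_nil, Seq.cons_append, Seq.nil_append,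
      stackTree_cons_of_notMem_calls hc]
    match b, ih with
    | [], _ => rfl
    | false :: b, ih => exact ih b (by simp)
    | true :: b, _ => rfl
  | unmatched hc =>
    rw [Seq.ofList_cons, Seq.ofList_nil, Seq.cons_append, Seq.nil_append,
      stackTree_unmatched hc (hv rfl)]
    match b, ih with
    | [], _ => rfl
    | false :: b, _ => rfl
    | true :: b, ih => exact ih b (by simp)
  | matched hc hr hw =>
    rw [Seq.ofList_cons, Seq.ofList_append, Seq.cons_append, Seq.append_assoc, Seq.ofList_cons,
      Seq.ofList_nil, Seq.cons_append, Seq.nil_append, stackTree_matched hc hr hw]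
    match b, ih with
    | [], _ => rfl
    | true :: b, _ => rfl
    | [false], _ => rfl
    | false :: true :: b, _ => rfl
    | false :: false :: b, ih => exact ih b (by simp)

theorem language_subset_stackTrees : S.stackAutomaton.language ⊆ stackTrees S := by
  rintro t ⟨r, ⟨h0, hr⟩, ha⟩
  -- The positions on the spine: a flag and a tree that is accepted with it.
  let X := {p : Bool × LabeledTree (Option A) // S.stackAutomaton.Accepts (.inf p.1 false) p.2}
  have key : ∀ s : X, ∃ (x : List A) (s' : X), S.TreeStep s.1.1 s.1.2 x s'.1.1 s'.1.2 := fun s => by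
    obtain ⟨x, u', t', h, h'⟩ := exists_treeStep s.2
    exact ⟨x, ⟨(u', t'), h'⟩, h⟩
  choose x f hf using key
  have hx : ∀ s, x s ≠ [] := fun s => (hf s).ne_nil
  set v : X → Seq A := fun s => ofStream (concatStream x hx f [] s) with hv
  have hstep : ∀ s, v s = append (ofList (x s)) (v (f s)) := concatStream_nil x hx f
  have hpos : ∀ s : X, s.1.1 = false → S.StaysPositive 1 (v s) := fun s hs =>
    staysPositive_of_append_step (P := fun s : X => s.1.1 = false) hx hstep
      (fun s hs => (hs ▸ hf s).target_eq_false) (fun s hs h hh => (hs ▸ hf s).staysPositive hh)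
      hs one_pos
  have main : ∀ n (b : TreeNode), b.length = n → ∀ s : X, s.1.2 b = stackTree S (v s) b := by
    intro n
    induction n using Nat.strong_induction_on with
    | _ n ih =>
    intro b hb s
    rw [hstep]
    exact (hf s).apply_eq_stackTree (hpos (f s)) b fun b' hb' => ih _ (hb ▸ hb') b' rfl _
  exact ⟨_, funext fun b => main _ b rfl ⟨(true, t), r, h0, hr, ha⟩⟩

end PushdownAlphabet

theorem theorem1 {A : Type*} [Finite A] (S : PushdownAlphabet A) :
    IsRegularTreeSet (stackTrees S) :=
  ⟨StackState, inferInstance, S.stackAutomaton,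
    S.language_subset_stackTrees.antisymm S.stackTrees_subset_language⟩
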